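/- \textbf{Theorem (Optimality of the Schatten exponent).} Let $N\ge 2$ and let $S\subset\mathbb R^N$ be a non-empty smooth embedded hypersurface (compact or not) whose Gauss curvature does not vanish at any point, endowed with its $(N-1)$-dimensional Lebesgue measure $d\sigma$. For $f\in L^1(S)$ put $$\mathcal E_Sf(x)=\frac1{(2\pi)^{N/2}}\int_S f(\xi)\,e^{i\xi\cdot x}\,d\sigma(\xi),\qquad x\in\mathbb R^N .$$ For a finite-rank operator $\gamma=\sum_j|g_j\rangle\langle h_j|$ on $L^2(S)$ with all $g_j,h_j\in L^1(S)\cap L^2(S)$ (every finite-rank operator is of this form if $S$ is compact), the density of $\mathcal E_S\gamma\mathcal E_S^*$ is $\rho_{\mathcal E_S\gamma\mathcal E_S^*}=\sum_j \mathcal E_Sg_j\,\overline{\mathcal E_Sh_j}$. For $\alpha>0$ let $\mathfrak S^\alpha(L^2(S))$ be the space of compact operators $T$ on $L^2(S)$ with $\|T\|_{\mathfrak S^\alpha}=\big(\sum_n\mu_n(T)^\alpha\big)^{1/\alpha}<\infty$, where $\mu_n(T)$ are the non-zero singular values of $T$ counted with multiplicity. Let $1\le q\le (N+1)/2$ and let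 $q'$ be the conjugate exponent of $q$. Then for every real $r>\frac{(N-1)q}{N(q-1)}$ (the right side being $+\infty$ if $q=1$), $$\sup_{\gamma}\ \frac{\|\rho_{\mathcal E_S\gamma\mathcal E_S^*}\|_{L^{q'}(\mathbb R^N)}}{\|\gamma\|_{\mathfrak S^r(L^2(S))}}=+\infty ,$$ where the supremum is over all non-zero $\gamma\in\mathfrak S^r(L^2(S))$ that are of finite rank and of the above form. That is, for no constant $C$ does $\|\rho_{\mathcal E_S\gamma\mathcal E_S^*}\|_{L^{q'}(\mathbb R^N)}\le C\|\gamma\|_{\mathfrak S^r(L^2(S))}$ hold for all these $\gamma$; so the Schatten exponent $\frac{(N-1)q}{N(q-1)}$ in the corresponding inequality for compact $S$ cannot be increased. -/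

import Mathlib

open MeasureTheory Filter Topology
open scoped ENNReal ContDiff InnerProductSpace InnerProduct

noncomputable section

/-! ### Smooth hypersurfaces of `ℝ^N`, their surface measure and Gauss curvature -/

/-- Near `p`, the set `S` is the graph of the smooth function `φ` over the hyperplane
`p + ν^⊥`, in the direction of the unit vector `ν`. Since `φ 0 = 0` and `dφ(0) = 0`, the point `p`
lies on `S` and `p + ν^⊥` is the tangent hyperplane of `S` at `p`. -/
structure IsTangentGraphAt {N : ℕ} (S : Set (EuclideanSpace ℝ (Fin N)))
    (p ν : EuclideanSpace ℝ (Fin N)) (φ : (ℝ ∙ ν)ᗮ → ℝ) : Prop where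
  norm_normal : ‖ν‖ = 1
  smooth : ContDiff ℝ ∞ φ
  map_zero : φ 0 = 0
  fderiv_zero : fderiv ℝ φ 0 = 0
  graph : ∀ᶠ x in 𝓝 p, x ∈ S ↔ ⟪ν, x - p⟫_ℝ = φ ((ℝ ∙ ν)ᗮ.orthogonalProjectionOnto (x - p))

/-- `S` is a smooth hypersurface embedded in `ℝ^N`: near each of its points it is the graph of a
smooth function over the tangent hyperplane. -/
def IsSmoothHypersurface {N : ℕ} (S : Set (EuclideanSpace ℝ (Fin N))) : Prop :=
  ∀ p ∈ S, ∃ (ν : EuclideanSpace ℝ (Fin N)) (φ : (ℝ ∙ ν)ᗮ → ℝ), IsTangentGraphAt S p ν φ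

/-- `κ` is the Gauss curvature of `S` at `p` with respect to one of the two unit normals:
the determinant of the second fundamental form, that is, of the Hessian at `0` of the function
whose graph over the tangent hyperplane is `S`, in an orthonormal basis of that hyperplane. -/
def HasGaussCurvatureAt {N : ℕ} (S : Set (EuclideanSpace ℝ (Fin N)))
    (p : EuclideanSpace ℝ (Fin N)) (κ : ℝ) : Prop :=
  ∃ (ν : EuclideanSpace ℝ (Fin N)) (φ : (ℝ ∙ ν)ᗮ → ℝ), IsTangentGraphAt S p ν φ ∧
    κ = (Matrix.of fun i j => iteratedFDeriv ℝ 2 φ 0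
      ![stdOrthonormalBasis ℝ (ℝ ∙ ν)ᗮ i, stdOrthonormalBasis ℝ (ℝ ∙ ν)ᗮ j]).det

/-- The `(N-1)`-dimensional Lebesgue measure `dσ` on `S ⊆ ℝ^N`, as a measure on `ℝ^N` (the
Hausdorff measure, normalized to be Lebesgue measure on hyperplanes, restricted to `S`). -/
def surfaceMeasure {N : ℕ} (S : Set (EuclideanSpace ℝ (Fin N))) :
    Measure (EuclideanSpace ℝ (Fin N)) :=
  (μHE[N - 1] : Measure (EuclideanSpace ℝ (Fin N))).restrict S

/-- The Hilbert space `L²(S, dσ)`. -/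
abbrev L2Surface {N : ℕ} (S : Set (EuclideanSpace ℝ (Fin N))) : Type :=
  Lp ℂ 2 (surfaceMeasure S)

/-- The extension operator
`(E_S f)(x) = (2π)^{-N/2} ∫_S f(ξ) e^{i ξ·x} dσ(ξ)`, for `f ∈ L¹(S)`. -/
def extensionOp {N : ℕ} (S : Set (EuclideanSpace ℝ (Fin N)))
    (f : EuclideanSpace ℝ (Fin N) → ℂ) (x : EuclideanSpace ℝ (Fin N)) : ℂ :=
  (((2 * Real.pi) ^ (-(N : ℝ) / 2) : ℝ) : ℂ) *
    ∫ ξ, f ξ * Complex.exp (Complex.I * ((⟪ξ, x⟫_ℝ : ℝ) : ℂ)) ∂(surfaceMeasure S)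

/-- `ρ` is the density of `E_S γ E_S^*`, where `γ = ∑ⱼ |gⱼ⟩⟨hⱼ|` is a finite-rank operator on
`L²(S)` with `gⱼ, hⱼ` in the domain `L¹(S)` of `E_S` (no restriction if `S` has finite area):
`ρ = ∑ⱼ (E_S gⱼ) * conj (E_S hⱼ)`, the diagonal of the integral kernel of `E_S γ E_S^*`, so that
`∫ ρ V = ∑ⱼ ⟨hⱼ, E_S^* V E_S gⱼ⟩ = tr (γ E_S^* V E_S)` for test functions `V`. -/
def IsDensity {N : ℕ} (S : Set (EuclideanSpace ℝ (Fin N)))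
    (γ : L2Surface S →L[ℂ] L2Surface S) (ρ : EuclideanSpace ℝ (Fin N) → ℂ) : Prop :=
  ∃ (n : ℕ) (g h : Fin n → L2Surface S),
    (∀ j, Integrable (g j) (surfaceMeasure S)) ∧ (∀ j, Integrable (h j) (surfaceMeasure S)) ∧
    γ = ∑ j, InnerProductSpace.rankOne ℂ (g j) (h j) ∧
    ∀ x, ρ x = ∑ j, extensionOp S (g j) x * (starRingEnd ℂ) (extensionOp S (h j) x)

/-! ### Schatten classes -/

section Schatten

variable {H : Type*} [NormedAddCommGroup H] [InnerProductSpace ℂ H] [CompleteSpace H]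

/-- The multiplicity of `μ > 0` as a singular value of `T`, that is, as an eigenvalue of
`√(T^* T)`; it is the dimension of the kernel of `T^* T - μ²`. -/
def singularMultiplicity (T : H →L[ℂ] H) (μ : ℝ) : ℕ :=
  Module.finrank ℂ (Module.End.eigenspace
    ((T.adjoint ∘L T : H →L[ℂ] H) : H →ₗ[ℂ] H) ((μ : ℂ) ^ 2))

/-- `∑ₙ μₙ(T)^α`, the sum over the nonzero singular values of `T` counted with multiplicity. -/
def schattenSum (α : ℝ) (T : H →L[ℂ] H) : ℝ≥0∞ :=
  ∑' μ : Set.Ioi (0 : ℝ), (singularMultiplicity T μ : ℝ≥0∞) * ENNReal.ofReal ((μ : ℝ) ^ α)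

/-- The Schatten class of exponent `α`: compact operators with `∑ₙ μₙ(T)^α < ∞`. -/
def MemSchatten (α : ℝ) (T : H →L[ℂ] H) : Prop :=
  IsCompactOperator T ∧ schattenSum α T < ⊤

/-- The Schatten norm `(∑ₙ μₙ(T)^α)^{1/α}` of a compact operator. -/
def schattenNorm (α : ℝ) (T : H →L[ℂ] H) : ℝ≥0∞ :=
  schattenSum α T ^ (1 / α)

end Schatten

/-- The Schatten exponent `(N-1) q / (N (q-1))`, for `N ≥ 2` and `q ≥ 1`; it is `∞` if `q = 1`. -/
def criticalSchattenExponent (N : ℕ) (q : ℝ) : ℝ≥0∞ :=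
  ENNReal.ofReal ((N - 1) * q) / ENNReal.ofReal (N * (q - 1))

end

/-! Cut a fixed patch `A` of `S` into `n ≲ M ^ (N - 1)` pieces of diameter `≲ 1 / M`, and let `γ`
project onto the span of their normalized indicators. On a ball of radius `≈ M` the phase `ξ·x`
barely varies over a piece, so each `|E_S u_k|²` is at least a constant times the area of its piece
(`measureReal_le_normSq_extensionOp`). Summing, `ρ ≳ σ(A)` on that ball, uniformly in `M`, hence
`‖ρ‖_{q'} ≳ M ^ (N / q')`. The nonzero singular values of `γ` are at most `n` ones, so its Schatten
norm is `≲ M ^ ((N - 1) / r)` (`schattenSum_sum_rankOne_le`). The ratio grows like `M ^ (N / q' - (N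
- 1) / r)`, and this exponent is positive exactly when `r > (N - 1) q / (N (q - 1))`. -/

/-! ### Patches of a hypersurface and their grid partitions -/

theorem LipschitzOnWith.euclideanHausdorffMeasure_image_le {X Y : Type*} [EMetricSpace X]
    [MeasurableSpace X] [BorelSpace X] [EMetricSpace Y] [MeasurableSpace Y] [BorelSpace Y]
    {K : NNReal} {f : X → Y} {s : Set X} (h : LipschitzOnWith K f s) (d : ℕ) :
    (μHE[d] : Measure Y) (f '' s) ≤ (K : ℝ≥0∞) ^ (d : ℝ) * (μHE[d] : Measure X) s := by
  simp_rw [Measure.euclideanHausdorffMeasure_def, Measure.smul_apply, ENNReal.smul_def, smul_eq_mul]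
  rw [mul_left_comm]
  gcongr
  exact h.hausdorffMeasure_image_le d.cast_nonneg

/-- A tangent graph contains a compact patch of positive finite area that is parametrized, with a
Lipschitz inverse of its coordinate map, by a subset of the unit cube of dimension `N - 1`. -/
theorem IsTangentGraphAt.exists_patch {N : ℕ} {S : Set (EuclideanSpace ℝ (Fin N))}
    {p ν : EuclideanSpace ℝ (Fin N)} {φ : (ℝ ∙ ν)ᗮ → ℝ} (h : IsTangentGraphAt S p ν φ) :
    ∃ (A : Set (EuclideanSpace ℝ (Fin N))) (C : ℝ)
      (F : EuclideanSpace ℝ (Fin N) → Fin (N - 1) → ℝ),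
      MeasurableSet A ∧ A ⊆ S ∧ μHE[N - 1] A ≠ 0 ∧ μHE[N - 1] A ≠ ⊤ ∧ 0 < C ∧ Measurable F ∧
      (∀ x ∈ A, ‖F x‖ ≤ 1) ∧ ∀ x ∈ A, ∀ y ∈ A, dist x y ≤ C * dist (F x) (F y) := by
  let W : Submodule ℝ (EuclideanSpace ℝ (Fin N)) := (ℝ ∙ ν)ᗮ
  have hν : ν ≠ 0 := by
    rintro rfl
    simpa using h.norm_normal
  have hrank : Module.finrank ℝ W = N - 1 := by
    have h1 := Submodule.finrank_add_finrank_orthogonal (ℝ ∙ ν)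
    rw [finrank_span_singleton hν, finrank_euclideanSpace_fin] at h1
    change 1 + Module.finrank ℝ W = N at h1
    omega
  -- The graph map, with left inverse `x ↦ P (x - p)`, `P` the orthogonal projection onto `W`.
  let ψ : W → EuclideanSpace ℝ (Fin N) := fun y => p + (y : EuclideanSpace ℝ (Fin N)) + φ y • ν
  have hψ : ContDiff ℝ ∞ ψ :=
    (contDiff_const.add W.subtypeL.contDiff).add (h.smooth.smul contDiff_const)
  have hψ0 : ψ 0 = p := by simp [ψ, h.map_zero]
  have hproj : ∀ y, W.orthogonalProjectionOnto (ψ y - p) = y := fun y => by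
    have : ψ y - p = (y : EuclideanSpace ℝ (Fin N)) + φ y • ν := by simp only [ψ]; abel
    rw [this, map_add, map_smul, Submodule.orthogonalProjectionOnto_mem_subspace_eq_self,
      Submodule.orthogonalProjectionOnto_orthogonalComplement_singleton_eq_zero, smul_zero,
      add_zero]
  have hinner : ∀ y, ⟪ν, ψ y - p⟫_ℝ = φ y := fun y => by
    have : ψ y - p = (y : EuclideanSpace ℝ (Fin N)) + φ y • ν := by simp only [ψ]; abel
    rw [this, inner_add_right, inner_smul_right, real_inner_self_eq_norm_sq, h.norm_normal,
      Submodule.mem_orthogonal_singleton_iff_inner_right.1 y.2]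
    simp
  have hmem : ∀ᶠ y in 𝓝 (0 : W), ψ y ∈ S := by
    have ht : Tendsto ψ (𝓝 0) (𝓝 p) := by
      simpa [hψ0] using hψ.continuous.tendsto 0
    filter_upwards [ht.eventually h.graph] with y hy
    rw [hy, hproj, hinner]
  let e : W ≃L[ℝ] (Fin (N - 1) → ℝ) :=
    ContinuousLinearEquiv.ofFinrankEq (by rw [hrank, Module.finrank_fin_fun])
  have hunit : ∀ᶠ y in 𝓝 (0 : W), ‖e y‖ < 1 := by
    have : Tendsto (fun y => ‖e y‖) (𝓝 0) (𝓝 0) := by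
      simpa using (e.continuous.norm.tendsto 0)
    exact this.eventually_lt_const one_pos
  obtain ⟨K, t, ht, hK⟩ := ((hψ.of_le (by simp)).contDiffAt (x := 0)).exists_lipschitzOnWith
  obtain ⟨δ, hδ, hball⟩ := Metric.nhds_basis_closedBall.mem_iff.1
    (inter_mem (inter_mem hmem hunit) ht)
  set B := Metric.closedBall (0 : W) δ
  have hvol : (μHE[N - 1] : Measure W) = volume := by
    rw [← hrank, InnerProductSpace.euclideanHausdorffMeasure_eq_volume]
  have hP : LipschitzWith 1 fun x => W.orthogonalProjectionOnto (x - p) :=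
    LipschitzWith.of_dist_le_mul fun x y => by
      have := W.lipschitzWith_orthogonalProjectionOnto.dist_le_mul (x - p) (y - p)
      simpa using this
  have himage : (fun x => W.orthogonalProjectionOnto (x - p)) '' (ψ '' B) = B := by
    rw [Set.image_image]
    simp [hproj]
  refine ⟨ψ '' B, K * ‖(e.symm : (Fin (N - 1) → ℝ) →L[ℝ] W)‖ + 1,
    fun x => e (W.orthogonalProjectionOnto (x - p)),
    ((isCompact_closedBall 0 δ).image hψ.continuous).measurableSet, ?_, ?_, ?_, by positivity,
    (e.continuous.comp hP.continuous).measurable, ?_, ?_⟩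
  · rintro _ ⟨y, hy, rfl⟩
    exact (hball hy).1.1
  -- The 1-Lipschitz projection maps the patch onto the ball `B`, so a null patch would make `B`
  -- null. Conversely `ψ` is Lipschitz on `B`, which bounds the area.
  · intro h0
    have h1 := (hP.lipschitzOnWith (s := ψ '' B)).euclideanHausdorffMeasure_image_le (N - 1)
    rw [himage, h0, hvol, mul_zero, nonpos_iff_eq_zero] at h1
    exact (Metric.measure_closedBall_pos volume (0 : W) hδ).ne' h1
  · have h1 := (hK.mono (show B ⊆ t from fun y hy =>
      (hball hy).2)).euclideanHausdorffMeasure_image_le (N - 1)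
    rw [hvol] at h1
    refine (h1.trans_lt (ENNReal.mul_lt_top ?_ measure_closedBall_lt_top)).ne
    exact ENNReal.rpow_lt_top_of_nonneg (by positivity) ENNReal.coe_ne_top
  · rintro _ ⟨y, hy, rfl⟩
    simp only [hproj]
    exact (hball hy).1.2.le
  · rintro _ ⟨y, hy, rfl⟩ _ ⟨z, hz, rfl⟩
    simp only [hproj]
    have h1 := hK.dist_le_mul y (hball hy).2 z (hball hz).2
    have h2 := (e.symm : (Fin (N - 1) → ℝ) →L[ℝ] W).dist_le_opNorm (e y) (e z)
    simp only [ContinuousLinearEquiv.coe_coe, ContinuousLinearEquiv.symm_apply_apply] at h2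
    have h3 := mul_le_mul_of_nonneg_left h2 K.coe_nonneg
    have := dist_nonneg (x := e y) (y := e z)
    linarith

/-- Cutting the coordinate cube into a grid of mesh `1 / M` partitions a patch into at most
`(3 M) ^ d` pieces of diameter at most `C / M`. -/
theorem exists_grid_partition {X : Type*} [PseudoMetricSpace X] [MeasurableSpace X] {d : ℕ}
    {A : Set X} {C : ℝ} {F : X → Fin d → ℝ} (hA : MeasurableSet A) (hC : 0 ≤ C)
    (hF : Measurable F) (hF1 : ∀ x ∈ A, ‖F x‖ ≤ 1)
    (hlip : ∀ x ∈ A, ∀ y ∈ A, dist x y ≤ C * dist (F x) (F y)) {M : ℕ} (hM : 1 ≤ M) :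
    ∃ (n : ℕ) (B : Fin n → Set X), n ≤ (3 * M) ^ d ∧ (∀ k, MeasurableSet (B k)) ∧
      Pairwise (Function.onFun Disjoint B) ∧ ⋃ k, B k = A ∧
      ∀ k, ∀ x ∈ B k, ∀ y ∈ B k, dist x y ≤ C / M := by
  have hM0 : (0 : ℝ) < M := by exact_mod_cast hM
  let G : X → Fin d → ℤ := fun x i => ⌊(M : ℝ) * F x i⌋
  have hG : Measurable G := measurable_pi_lambda _ fun i =>
    Int.measurable_floor.comp (((measurable_pi_apply i).comp hF).const_mul _)
  let T : Finset (Fin d → ℤ) := Fintype.piFinset fun _ => Finset.Icc (-M : ℤ) M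
  have hcard : T.card ≤ (3 * M) ^ d := by
    rw [Fintype.card_piFinset_const, Int.card_Icc]
    -- Each coordinate has `2 M + 1 ≤ 3 M` possible floors, as `M ≥ 1`.
    exact Nat.pow_le_pow_left (by omega) d
  refine ⟨T.card, fun k => A ∩ G ⁻¹' {(T.equivFin.symm k : Fin d → ℤ)}, hcard,
    fun k => hA.inter (hG (measurableSet_singleton _)), fun k l hkl => ?_, ?_, ?_⟩
  · refine Set.disjoint_left.2 fun x hx hy => hkl ?_
    apply T.equivFin.symm.injective
    exact Subtype.ext (hx.2.symm.trans hy.2)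
  · ext x
    simp only [Set.mem_iUnion, Set.mem_inter_iff, Set.mem_preimage, Set.mem_singleton_iff,
      exists_and_left, and_iff_left_iff_imp]
    intro hx
    have hGx : G x ∈ T := by
      refine Fintype.mem_piFinset.2 fun i => Finset.mem_Icc.2 ?_
      have h1 := abs_le.1 ((norm_le_pi_norm (F x) i).trans (hF1 x hx))
      constructor
      · rw [Int.le_floor]
        push_cast
        nlinarith
      · have h2 : ((⌊(M : ℝ) * F x i⌋ : ℤ) : ℝ) ≤ ((M : ℤ) : ℝ) := by
          refine (Int.floor_le _).trans ?_
          push_cast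
          nlinarith
        exact_mod_cast h2
    exact ⟨T.equivFin ⟨G x, hGx⟩, by simp⟩
  · rintro k x ⟨hx, hxk⟩ y ⟨hy, hyk⟩
    refine (hlip x hx y hy).trans ?_
    rw [div_eq_mul_one_div]
    refine mul_le_mul_of_nonneg_left ((dist_pi_le_iff (by positivity)).2 fun i => ?_) hC
    have hxy : ⌊(M : ℝ) * F x i⌋ = ⌊(M : ℝ) * F y i⌋ :=
      congrFun ((show G x = _ from hxk).trans (show G y = _ from hyk).symm) i
    have h1 := Int.abs_sub_lt_one_of_floor_eq_floor hxy
    rw [← mul_sub, abs_mul, abs_of_pos hM0] at h1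
    rw [Real.dist_eq, le_div_iff₀ hM0, mul_comm]
    exact h1.le

/-! ### Finite-rank projections and their Schatten sums -/

section Projection

variable {H : Type*} [NormedAddCommGroup H] [InnerProductSpace ℂ H]

theorem isCompactOperator_rankOne (x y : H) :
    IsCompactOperator (InnerProductSpace.rankOne ℂ x y) := by
  rw [InnerProductSpace.rankOne_def']
  have h : IsCompactOperator (ContinuousLinearMap.toSpanSingleton ℂ x) :=
    (isCompactOperator_id (E := ℂ)).clm_comp (ContinuousLinearMap.toSpanSingleton ℂ x)
  exact h.comp_clm (innerSL ℂ y)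

theorem isCompactOperator_sum_rankOne {ι : Type*} (s : Finset ι) (g h : ι → H) :
    IsCompactOperator ((∑ j ∈ s, InnerProductSpace.rankOne ℂ (g j) (h j) : H →L[ℂ] H)) :=
  Submodule.sum_mem (compactOperator (RingHom.id ℂ) H H) fun j _ =>
    isCompactOperator_rankOne (g j) (h j)

/-- The condition `hself` means that each `u i` is a unit vector or zero; zero must be allowed
because grid pieces may be null. -/
theorem sum_rankOne_apply_self {n : ℕ} {u : Fin n → H}
    (horth : ∀ i j, i ≠ j → ⟪u i, u j⟫_ℂ = 0) (hself : ∀ i, ⟪u i, u i⟫_ℂ • u i = u i) (i : Fin n) :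
    (∑ j, InnerProductSpace.rankOne ℂ (u j) (u j)) (u i) = u i := by
  rw [sum_apply,
    Finset.sum_eq_single i (fun j _ hj => by simp [horth j i hj]) (by simp)]
  exact hself i

variable [CompleteSpace H]

/-- A sum of `n` mutually orthogonal rank-one projections has at most `n` nonzero singular
values, all equal to `1`. -/
theorem schattenSum_sum_rankOne_le {n : ℕ} {u : Fin n → H}
    (horth : ∀ i j, i ≠ j → ⟪u i, u j⟫_ℂ = 0) (hself : ∀ i, ⟪u i, u i⟫_ℂ • u i = u i) (α : ℝ) :
    schattenSum α (∑ j, InnerProductSpace.rankOne ℂ (u j) (u j)) ≤ n := by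
  set T : H →L[ℂ] H := ∑ j, InnerProductSpace.rankOne ℂ (u j) (u j)
  have hT : ∀ v, T v = ∑ j, ⟪u j, v⟫_ℂ • u j := fun v => by simp [T]
  have hTu : ∀ i, T (u i) = u i := sum_rankOne_apply_self horth hself
  have hTT : ∀ v, T (T v) = T v := fun v => by
    conv_lhs => rw [hT v, map_sum]
    simp_rw [map_smul, hTu]
    exact (hT v).symm
  have hadj : T.adjoint = T := by simp [T, map_sum]
  have hcomp : T.adjoint ∘L T = T := by
    rw [hadj]
    exact ContinuousLinearMap.ext hTT
  have hrange : ∀ v, T v ∈ Submodule.span ℂ (Set.range u) := fun v => by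
    rw [hT]
    exact Submodule.sum_mem _ fun j _ =>
      Submodule.smul_mem _ _ (Submodule.subset_span (Set.mem_range_self j))
  -- Since `T` is idempotent, an eigenvalue `μ ^ 2` satisfies `μ ^ 4 = μ ^ 2`, which for `μ > 0`
  -- leaves only `μ = 1`.
  have hmult : ∀ μ : Set.Ioi (0 : ℝ), μ ≠ ⟨1, Set.mem_Ioi.2 one_pos⟩ → singularMultiplicity T μ = 0 := by
    rintro ⟨μ, hμ⟩ hne
    have hμ0 : (0 : ℝ) < μ := hμ
    rw [singularMultiplicity, hcomp]
    suffices Module.End.eigenspace (T : H →ₗ[ℂ] H) ((μ : ℂ) ^ 2) = ⊥ by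
      rw [this, finrank_bot]
    refine (Submodule.eq_bot_iff _).2 fun v hv => ?_
    have h1 : T v = (μ : ℂ) ^ 2 • v := Module.End.mem_eigenspace_iff.1 hv
    have h2 := hTT v
    rw [h1, map_smul, h1, smul_smul, ← sub_eq_zero, ← sub_smul] at h2
    refine (smul_eq_zero.1 h2).resolve_left fun h3 => hne ?_
    have h4 : μ ^ 2 * μ ^ 2 - μ ^ 2 = 0 := by exact_mod_cast h3
    have h5 : μ ^ 2 * ((μ - 1) * (μ + 1)) = 0 := by linarith
    have h6 : μ - 1 = 0 := by
      rcases mul_eq_zero.1 h5 with h | h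
      · exact absurd h (by positivity)
      · exact (mul_eq_zero.1 h).resolve_right (by positivity)
    exact Subtype.ext (sub_eq_zero.1 h6)
  rw [schattenSum, tsum_eq_single ⟨1, Set.mem_Ioi.2 one_pos⟩ fun μ hμ => by rw [hmult μ hμ]; simp]
  simp only [Real.one_rpow, ENNReal.ofReal_one, mul_one, Nat.cast_le]
  rw [singularMultiplicity, hcomp]
  have hle : Module.End.eigenspace (T : H →ₗ[ℂ] H) (((1 : ℝ) : ℂ) ^ 2) ≤
      Submodule.span ℂ (Set.range u) := fun v hv => by
    have h1 : T v = (((1 : ℝ) : ℂ) ^ 2) • v := Module.End.mem_eigenspace_iff.1 hv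
    rw [Complex.ofReal_one, one_pow, one_smul] at h1
    exact h1 ▸ hrange v
  have : FiniteDimensional ℂ (Submodule.span ℂ (Set.range u)) :=
    FiniteDimensional.span_of_finite ℂ (Set.finite_range u)
  refine (Submodule.finrank_mono hle).trans ?_
  exact (finrank_range_le_card (R := ℂ) u).trans_eq (Fintype.card_fin n)

end Projection

/-! ### Lower bounds for extensions and densities -/

/-- If the phase oscillates by at most `1 / 2` on `s`, there is little cancellation. -/
theorem half_measureReal_le_norm_setIntegral_exp {X : Type*} [MeasurableSpace X] {μ : Measure X}
    {s : Set X} {θ : X → ℝ} (hμs : μ s ≠ ⊤) (hθm : AEStronglyMeasurable θ (μ.restrict s))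
    (hθ : ∀ x ∈ s, ∀ y ∈ s, |θ x - θ y| ≤ 1 / 2) :
    μ.real s / 2 ≤ ‖∫ x in s, Complex.exp (Complex.I * θ x) ∂μ‖ := by
  rcases s.eq_empty_or_nonempty with rfl | ⟨y, hy⟩
  · simp
  have : IsFiniteMeasure (μ.restrict s) := isFiniteMeasure_restrict.2 hμs
  have hint : Integrable (fun x => Complex.exp (Complex.I * θ x)) (μ.restrict s) := by
    refine Integrable.of_bound (C := 1) ?_ (Eventually.of_forall fun x => ?_)
    · exact (Complex.continuous_exp.comp
        (continuous_const.mul Complex.continuous_ofReal)).comp_aestronglyMeasurable hθm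
    · rw [mul_comm, Complex.norm_exp_ofReal_mul_I]
  have h1 : ‖∫ x in s, (Complex.exp (Complex.I * θ x) - Complex.exp (Complex.I * θ y)) ∂μ‖
      ≤ 1 / 2 * μ.real s := by
    refine norm_setIntegral_le_of_norm_le_const hμs.lt_top fun x hx => ?_
    -- Factoring out the unimodular phase at `y` allows the bound `|e^{it} - 1| ≤ |t|`.
    have h2 : Complex.exp (Complex.I * θ x) - Complex.exp (Complex.I * θ y) =
        Complex.exp (θ y * Complex.I) *
          (Complex.exp (Complex.I * ((θ x - θ y : ℝ) : ℂ)) - 1) := by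
      rw [mul_sub, ← Complex.exp_add, mul_one, mul_comm (θ y : ℂ)]
      push_cast
      ring_nf
    rw [h2, norm_mul, Complex.norm_exp_ofReal_mul_I, one_mul]
    exact Real.norm_exp_I_mul_ofReal_sub_one_le.trans (hθ x hx y hy)
  rw [integral_sub hint (integrable_const _), integral_const, measureReal_restrict_apply_univ] at h1
  have h3 : ‖μ.real s • Complex.exp (Complex.I * θ y)‖ = μ.real s := by
    rw [norm_smul, mul_comm Complex.I, Complex.norm_exp_ofReal_mul_I, mul_one,
      Real.norm_of_nonneg measureReal_nonneg]
  have h4 := norm_sub_norm_le (μ.real s • Complex.exp (Complex.I * θ y))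
    (∫ x in s, Complex.exp (Complex.I * θ x) ∂μ)
  rw [norm_sub_rev, h3] at h4
  linarith

theorem extensionOp_indicatorConstLp {N : ℕ} {S s : Set (EuclideanSpace ℝ (Fin N))}
    (hs : MeasurableSet s) (hμs : surfaceMeasure S s ≠ ⊤) (c : ℂ)
    (x : EuclideanSpace ℝ (Fin N)) :
    extensionOp S (indicatorConstLp 2 hs hμs c) x =
      (((2 * Real.pi) ^ (-(N : ℝ) / 2) : ℝ) : ℂ) *
        (c * ∫ ξ in s, Complex.exp (Complex.I * ((⟪ξ, x⟫_ℝ : ℝ) : ℂ)) ∂(surfaceMeasure S)) := by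
  rw [extensionOp]
  refine congrArg _ ?_
  rw [← integral_const_mul c, ← integral_indicator hs]
  refine integral_congr_ae ?_
  filter_upwards [indicatorConstLp_coeFn (p := 2) (hs := hs) (hμs := hμs) (c := c)] with ξ hξ
  rw [hξ]
  by_cases h : ξ ∈ s <;> simp [h]

/-- The extension of the normalized indicator of a small piece of `S` does not decay on the ball
whose radius is inverse to the diameter of the piece. -/
theorem measureReal_le_normSq_extensionOp {N : ℕ} {S s : Set (EuclideanSpace ℝ (Fin N))}
    (hs : MeasurableSet s) (hμs : surfaceMeasure S s ≠ ⊤) {D : ℝ}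
    (hD : ∀ ξ ∈ s, ∀ η ∈ s, dist ξ η ≤ D) {x : EuclideanSpace ℝ (Fin N)} (hx : D * ‖x‖ ≤ 1 / 2) :
    ((2 * Real.pi) ^ (-(N : ℝ) / 2)) ^ 2 / 4 * (surfaceMeasure S).real s ≤
      ‖extensionOp S
        (indicatorConstLp 2 hs hμs (((√((surfaceMeasure S).real s))⁻¹ : ℝ) : ℂ)) x‖ ^ 2 := by
  set m := (surfaceMeasure S).real s
  have hm : 0 ≤ m := measureReal_nonneg
  have hcont : Continuous fun ξ : EuclideanSpace ℝ (Fin N) => ⟪ξ, x⟫_ℝ := by fun_prop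
  have h1 : m / 2 ≤ _ := half_measureReal_le_norm_setIntegral_exp (θ := fun ξ => ⟪ξ, x⟫_ℝ) hμs
    hcont.aestronglyMeasurable fun ξ hξ η hη => by
      rw [← inner_sub_left]
      refine (abs_real_inner_le_norm _ _).trans (le_trans ?_ hx)
      rw [← dist_eq_norm]
      exact mul_le_mul_of_nonneg_right (hD ξ hξ η hη) (norm_nonneg x)
  rw [extensionOp_indicatorConstLp, norm_mul, norm_mul, mul_pow, mul_pow, Complex.norm_real,
    Complex.norm_real, Real.norm_eq_abs, Real.norm_eq_abs, sq_abs, sq_abs, inv_pow, Real.sq_sqrt hm,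
    div_mul_eq_mul_div, mul_div_assoc]
  refine mul_le_mul_of_nonneg_left ?_ (sq_nonneg _)
  -- On a null piece the normalizing factor is `0⁻¹ = 0`, and both sides vanish.
  rcases hm.eq_or_lt with h0 | h0
  · rw [← h0]
    simp
  · rw [inv_mul_eq_div, le_div_iff₀ h0]
    nlinarith [pow_le_pow_left₀ (by positivity) h1 2]

/-- The projection onto the span of the indicators of `n` disjoint small pieces of `S` has a
density that is bounded below, by the total area of the pieces, on a large ball. -/
theorem exists_isDensity_of_disjoint_pieces {N n : ℕ} {S : Set (EuclideanSpace ℝ (Fin N))}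
    {B : Fin n → Set (EuclideanSpace ℝ (Fin N))} (hB : ∀ k, MeasurableSet (B k))
    (hdisj : Pairwise (Function.onFun Disjoint B)) (hfin : ∀ k, surfaceMeasure S (B k) ≠ ⊤)
    (hpos : 0 < (surfaceMeasure S).real (⋃ k, B k)) {D : ℝ}
    (hD : ∀ k, ∀ ξ ∈ B k, ∀ η ∈ B k, dist ξ η ≤ D) :
    ∃ (γ : L2Surface S →L[ℂ] L2Surface S) (ρ : EuclideanSpace ℝ (Fin N) → ℂ),
      γ ≠ 0 ∧ IsDensity S γ ρ ∧ IsCompactOperator γ ∧ (∀ α, schattenSum α γ ≤ n) ∧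
      ∀ x, D * ‖x‖ ≤ 1 / 2 →
        ((2 * Real.pi) ^ (-(N : ℝ) / 2)) ^ 2 / 4 * (surfaceMeasure S).real (⋃ k, B k) ≤ ‖ρ x‖ := by
  let m : Fin n → ℝ := fun k => (surfaceMeasure S).real (B k)
  let u : Fin n → L2Surface S := fun k =>
    indicatorConstLp 2 (hB k) (hfin k) (((√(m k))⁻¹ : ℝ) : ℂ)
  have hsum : (surfaceMeasure S).real (⋃ k, B k) = ∑ k, m k :=
    measureReal_iUnion_fintype hdisj hB hfin
  have hinner : ∀ i, m i ≠ 0 → ⟪u i, u i⟫_ℂ = 1 := fun i hi => by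
    have hmi : 0 < m i := lt_of_le_of_ne measureReal_nonneg hi.symm
    simp only [u]
    rw [L2.inner_indicatorConstLp_indicatorConstLp (hB i) (hB i) (hfin i) (hfin i), Set.inter_self, inner_self_eq_norm_sq_to_K]
    change (m i) • ((‖(((√(m i))⁻¹ : ℝ) : ℂ)‖ : ℝ) : ℂ) ^ 2 = 1
    rw [Complex.norm_real, Real.norm_eq_abs, ← Complex.ofReal_pow, sq_abs, inv_pow,
      Real.sq_sqrt hmi.le, Complex.real_smul, ← Complex.ofReal_mul, mul_inv_cancel₀ hi,
      Complex.ofReal_one]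
  have horth : ∀ i j, i ≠ j → ⟪u i, u j⟫_ℂ = 0 := fun i j hij => by
    simp only [u]
    rw [L2.inner_indicatorConstLp_indicatorConstLp (hB i) (hB j) (hfin i) (hfin j), (hdisj hij).inter_eq, measureReal_empty,
      zero_smul]
  have hself : ∀ i, ⟪u i, u i⟫_ℂ • u i = u i := fun i => by
    by_cases hi : m i = 0
    · have : u i = 0 := by
        simpa [u, hi] using norm_indicatorConstLp_le (p := 2) (hs := hB i) (hμs := hfin i)
          (c := (((√(m i))⁻¹ : ℝ) : ℂ))
      rw [this, smul_zero]
    · rw [hinner i hi, one_smul]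
  refine ⟨∑ j, InnerProductSpace.rankOne ℂ (u j) (u j),
    fun x => ∑ j, extensionOp S (u j) x * (starRingEnd ℂ) (extensionOp S (u j) x), ?_,
    ⟨n, u, u, fun j => integrable_indicatorConstLp _ _ _, fun j => integrable_indicatorConstLp _ _ _,
      rfl, fun _ => rfl⟩, isCompactOperator_sum_rankOne _ _ _,
    fun α => schattenSum_sum_rankOne_le horth hself α, fun x hx => ?_⟩
  · intro h0
    obtain ⟨i, -, hi⟩ := Finset.exists_ne_zero_of_sum_ne_zero (hsum ▸ hpos).ne'
    have h1 := sum_rankOne_apply_self horth hself i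
    rw [h0, zero_apply] at h1
    have h2 := hinner i hi
    rw [← h1, inner_zero_left] at h2
    exact zero_ne_one h2
  · have h1 : ∑ j, extensionOp S (u j) x * (starRingEnd ℂ) (extensionOp S (u j) x) =
        ((∑ j, ‖extensionOp S (u j) x‖ ^ 2 : ℝ) : ℂ) := by
      simp [Complex.mul_conj, Complex.normSq_eq_norm_sq]
    beta_reduce
    rw [h1, Complex.norm_real, hsum, Finset.mul_sum]
    exact (Finset.sum_le_sum fun k _ =>
      measureReal_le_normSq_extensionOp (hB k) (hfin k) (hD k) hx).trans (le_abs_self _)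

/-! ### Comparison of the powers of `M` -/

theorem ofReal_mul_le_eLpNorm_of_le_norm_on_closedBall {N : ℕ} {ρ : EuclideanSpace ℝ (Fin N) → ℂ}
    {c R : ℝ} (hc : 0 ≤ c) (hR : 0 < R) (hρ : ∀ x, ‖x‖ ≤ R → c ≤ ‖ρ x‖) {p : ℝ≥0∞} (hp0 : p ≠ 0)
    (hp : p ≠ ⊤) :
    ENNReal.ofReal (c * (R ^ N * (volume : Measure (EuclideanSpace ℝ (Fin N))).real
      (Metric.ball 0 1)) ^ (1 / p.toReal)) ≤ eLpNorm ρ p volume := by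
  have h1 : eLpNorm ((Metric.closedBall (0 : EuclideanSpace ℝ (Fin N)) R).indicator fun _ => c) p
      volume ≤ eLpNorm ρ p volume := by
    refine eLpNorm_mono fun x => ?_
    by_cases hx : x ∈ Metric.closedBall (0 : EuclideanSpace ℝ (Fin N)) R
    · rw [Set.indicator_of_mem hx, Real.norm_of_nonneg hc]
      exact hρ x (by simpa using hx)
    · rw [Set.indicator_of_notMem hx, norm_zero]
      exact norm_nonneg _
  refine le_trans (le_of_eq ?_) h1
  rw [eLpNorm_indicator_const measurableSet_closedBall hp0 hp, Measure.addHaar_closedBall _ _ hR.le,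
    finrank_euclideanSpace_fin, ENNReal.ofReal_mul hc, Real.enorm_of_nonneg hc,
    ← ENNReal.ofReal_rpow_of_nonneg (by positivity) (by positivity),
    ENNReal.ofReal_mul (by positivity), ofReal_measureReal measure_ball_lt_top.ne]

theorem ENNReal.conjExponent_ofReal {q : ℝ} (hq : 1 < q) :
    ENNReal.conjExponent (ENNReal.ofReal q) = ENNReal.ofReal (q / (q - 1)) := by
  have h0 : 0 < q - 1 := sub_pos.2 hq
  rw [ENNReal.conjExponent, ← ENNReal.ofReal_one, ← ENNReal.ofReal_sub _ zero_le_one,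
    ← ENNReal.ofReal_inv_of_pos h0, ← ENNReal.ofReal_add zero_le_one (by positivity)]
  congr 1
  field_simp
  ring

theorem iSup_eLpNorm_div_schattenNorm_eq_top {N : ℕ} (hN : 2 ≤ N)
    {S : Set (EuclideanSpace ℝ (Fin N))} (hS_ne : S.Nonempty) (hS : IsSmoothHypersurface S)
    {q : ℝ} (hq : 1 < q) {r : ℝ} (hr : (N - 1) * q / (N * (q - 1)) < r) :
    (⨆ (γ : L2Surface S →L[ℂ] L2Surface S) (_ : MemSchatten r γ) (_ : γ ≠ 0)
        (ρ : EuclideanSpace ℝ (Fin N) → ℂ) (_ : IsDensity S γ ρ),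
      eLpNorm ρ (ENNReal.conjExponent (ENNReal.ofReal q)) volume / schattenNorm r γ) = ⊤ := by
  have hq0 : 0 < q - 1 := sub_pos.2 hq
  have hN0 : (0 : ℝ) < N := by positivity
  have hN1 : (0 : ℝ) < N - 1 := by
    have : (2 : ℝ) ≤ N := by exact_mod_cast hN
    linarith
  have hcast : ((N - 1 : ℕ) : ℝ) = N - 1 := by push_cast [show 1 ≤ N by omega]; rfl
  have hr0 : 0 < r := lt_of_le_of_lt (by positivity) hr
  obtain ⟨p, hp⟩ := hS_ne
  obtain ⟨ν, φ, hφ⟩ := hS p hp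
  obtain ⟨A, C, F, hA, hAS, hA0, hAtop, hC, hF, hF1, hlip⟩ := hφ.exists_patch
  have hσ : ∀ s, MeasurableSet s → s ⊆ A → surfaceMeasure S s = μHE[N - 1] s := fun s hs hsA => by
    rw [surfaceMeasure, Measure.restrict_apply hs, Set.inter_eq_self_of_subset_left (hsA.trans hAS)]
  have hσA : 0 < (surfaceMeasure S).real A := by
    rw [measureReal_def, hσ A hA subset_rfl]
    exact ENNReal.toReal_pos hA0 hAtop
  -- This is `1 / q'`.
  set a : ℝ := (q - 1) / q with ha
  set v := (volume : Measure (EuclideanSpace ℝ (Fin N))).real (Metric.ball 0 1)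
  have hv : 0 < v := ENNReal.toReal_pos (Metric.measure_ball_pos _ _ one_pos).ne'
    measure_ball_lt_top.ne
  set c := ((2 * Real.pi) ^ (-(N : ℝ) / 2)) ^ 2 / 4 * (surfaceMeasure S).real A
  have hc : 0 < c := by positivity
  set K := c * ((1 / (2 * C)) ^ N * v) ^ a / (3 : ℝ) ^ ((N - 1) / r)
  have hK : 0 < K := by positivity
  -- The lower bound on `r` makes the growth exponent positive.
  have hβ : 0 < N * a - (N - 1) / r := by
    rw [ha, sub_pos, div_lt_iff₀ hr0]
    rw [div_lt_iff₀ (by positivity)] at hr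
    rw [← mul_div_assoc, div_mul_eq_mul_div, lt_div_iff₀ (by positivity)]
    linarith
  have hlim : Tendsto (fun M : ℕ => ENNReal.ofReal (K * (M : ℝ) ^ (N * a - (N - 1) / r))) atTop
      (𝓝 ⊤) :=
    ENNReal.tendsto_ofReal_nhds_top.2
      (((tendsto_rpow_atTop hβ).comp tendsto_natCast_atTop_atTop).const_mul_atTop hK)
  refine top_unique (le_of_tendsto hlim ((eventually_ge_atTop 1).mono fun M hM => ?_))
  have hM0 : (0 : ℝ) < M := by exact_mod_cast hM
  obtain ⟨n, B, hn, hB, hdisj, hunion, hdiam⟩ := exists_grid_partition hA hC.le hF hF1 hlip hM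
  have hfin : ∀ k, surfaceMeasure S (B k) ≠ ⊤ := fun k => by
    have hk : B k ⊆ A := hunion ▸ Set.subset_iUnion B k
    rw [hσ _ (hB k) hk]
    exact measure_ne_top_of_subset hk hAtop
  obtain ⟨γ, ρ, hγ, hρ, hcomp, hsum, hlow⟩ :=
    exists_isDensity_of_disjoint_pieces hB hdisj hfin (by rwa [hunion]) hdiam
  rw [hunion] at hlow
  have hmem : MemSchatten r γ := ⟨hcomp, (hsum r).trans_lt (ENNReal.natCast_lt_top n)⟩
  refine le_trans ?_ (le_iSup₂_of_le γ hmem (le_iSup₂_of_le hγ ρ (le_iSup_of_le hρ le_rfl)))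
  -- This radius times the diameter bound `C / M` is `1 / 2`, the allowed phase oscillation.
  have hnum := ofReal_mul_le_eLpNorm_of_le_norm_on_closedBall (R := M / (2 * C))
    (p := ENNReal.conjExponent (ENNReal.ofReal q)) hc.le (by positivity)
    (fun x hx => hlow x (by
      calc C / M * ‖x‖ ≤ C / M * (M / (2 * C)) := by gcongr
        _ = 1 / 2 := by field_simp))
    (by rw [ENNReal.conjExponent_ofReal hq]; exact (ENNReal.ofReal_pos.2 (by positivity)).ne')
    (by rw [ENNReal.conjExponent_ofReal hq]; exact ENNReal.ofReal_ne_top)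
  have hap : 1 / (ENNReal.conjExponent (ENNReal.ofReal q)).toReal = a := by
    rw [ENNReal.conjExponent_ofReal hq, ENNReal.toReal_ofReal (by positivity), one_div_div]
  rw [hap] at hnum
  have hden : schattenNorm r γ ≤ ENNReal.ofReal ((3 * M : ℝ) ^ ((N - 1) / r)) := by
    have h1 : (n : ℝ≥0∞) ≤ ENNReal.ofReal ((3 * M : ℝ) ^ ((N - 1 : ℕ) : ℝ)) := by
      rw [Real.rpow_natCast, ← ENNReal.ofReal_natCast]
      exact ENNReal.ofReal_le_ofReal (by exact_mod_cast hn)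
    refine (ENNReal.rpow_le_rpow ((hsum r).trans h1) (by positivity)).trans_eq ?_
    rw [ENNReal.ofReal_rpow_of_nonneg (by positivity) (by positivity),
      ← Real.rpow_mul (by positivity), hcast, mul_one_div]
  refine le_trans (le_of_eq ?_) (ENNReal.div_le_div hnum hden)
  rw [← ENNReal.ofReal_div_of_pos (by positivity)]
  congr 1
  have h1 : ((M / (2 * C)) ^ N * v) ^ a = ((1 / (2 * C)) ^ N * v) ^ a * (M : ℝ) ^ (N * a) := by
    rw [Real.rpow_mul hM0.le, Real.rpow_natCast, ← Real.mul_rpow (by positivity) (by positivity)]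
    congr 1
    rw [div_eq_mul_one_div, mul_pow]
    ring
  rw [h1, Real.rpow_sub hM0, Real.mul_rpow (by norm_num) hM0.le]
  simp only [K]
  field_simp

theorem mainTheorem6 (N : ℕ) (hN : 2 ≤ N) (S : Set (EuclideanSpace ℝ (Fin N)))
    (hS_ne : S.Nonempty) (hS : IsSmoothHypersurface S)
    (hS_curv : ∀ p ∈ S, ∀ κ : ℝ, HasGaussCurvatureAt S p κ → κ ≠ 0)
    (q : ℝ) (hq_one : 1 ≤ q) (hq_le : q ≤ ((N : ℝ) + 1) / 2)
    (r : ℝ) (hr : criticalSchattenExponent N q < ENNReal.ofReal r) :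
    (⨆ (γ : L2Surface S →L[ℂ] L2Surface S) (_ : MemSchatten r γ) (_ : γ ≠ 0)
        (ρ : EuclideanSpace ℝ (Fin N) → ℂ) (_ : IsDensity S γ ρ),
      eLpNorm ρ (ENNReal.conjExponent (ENNReal.ofReal q)) volume / schattenNorm r γ) = ⊤ := by
  have hN2 : (2 : ℝ) ≤ N := by exact_mod_cast hN
  rw [criticalSchattenExponent] at hr
  rcases hq_one.eq_or_lt with rfl | hq
  -- For `q = 1` the critical exponent is `⊤`, so no real `r` exceeds it.
  · rw [sub_self, mul_zero, ENNReal.ofReal_zero, ENNReal.div_zero] at hr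
    · exact absurd hr not_top_lt
    · exact (ENNReal.ofReal_pos.2 (by linarith)).ne'
  · have hq0 : 0 < q - 1 := sub_pos.2 hq
    rw [← ENNReal.ofReal_div_of_pos (by positivity)] at hr
    exact iSup_eLpNorm_div_schattenNorm_eq_top hN hS_ne hS hq (ENNReal.ofReal_lt_ofReal_iff'.1 hr).1
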